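/- Let $\mathcal I=\{-,0,+\}$. A word $x\in\mathcal I^n$ describes the closed sub-cube $|x|=\{p\in[-1,1]^n : p_i=-1 \text{ if } x_i=-,\ p_i=1 \text{ if } x_i=+\}$ of $[-1,1]^n$; the boundary of $|x|$ is the union of its proper faces. For a set $A$ of words of length $n$ put $|A|=\bigcup_{x\in A}|x|$. Let $\lambda,\mu,\nu:\mathcal I^{n}\to\mathcal I^{n+1}$ append the symbol $-$, $0$, $+$, respectively, at the right end of a word. Define sets of words $\psi_k[n],\omega_k[n]\subset\mathcal I^n$ by $\psi_0[n]=\{-\cdots-\}$, $\omega_0[n]=\{+\cdots+\}$, $\psi_k[n]=\omega_k[n]=\{0\cdots0\}$ for $k\ge n$, and, for $1\le k<n$, $$\psi_k[n]=\mu\psi_{k-1}[n-1]\cup\lambda\psi_k[n-1],\qquad \omega_k[n]=\nu\omega_k[n-1]\cup\mu\omega_{k-1}[n-1]\qquad(k\text{ even}),$$ $$\psi_k[n]=\mu\psi_{k-1}[n-1]\cup\nu\psi_k[n-1],\qquad \omega_k[n]=\lambda\omega_k[n-1]\cup\mu\omega_{k-1}[n-1]\qquad(k\text{ odd}).$$ **Theorem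 4.2.** Let $0\le k\le n$ and let $A$ be $\psi_k[n]$ or $\omega_k[n]$. Let $D_k$ be the quotient of the disjoint union of the sub-cubes $|x|$, $x\in A$, by the equivalence relation that identifies boundary points of different sub-cubes whenever they are the same point of $[-1,1]^n$. (i) $D_k$ is a topological $k$-disk, that is, homeomorphic to the closed unit ball of $\mathbb R^k$. (ii) If $k\ge1$, then $\partial D_k=|\psi_{k-1}[n]|\cup|\omega_{k-1}[n]|$: the homeomorphism in (i) can be chosen so that the points of $D_k$ that it sends to the unit sphere have as their image, under the natural map $D_k\to[-1,1]^n$, exactly the set $|\psi_{k-1}[n]|\cup|\omega_{k-1}[n]|$. -/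

import Mathlib

namespace OrientedCube

/-- A sub-cube of the `n`-cube, as a word of length `n` in the symbols `-`, `0`, `+`
(here `-1`, `0`, `1`), where `0` stands for the whole interval `[-1, 1]`. -/
abbrev Word (n : ℕ) : Type := Fin n → SignType

/-- `lam` (λ), `mu` (μ) and `nu` (ν) append `-`, `0` and `+` to the right of a word. -/
def lam {n : ℕ} (x : Word n) : Word (n + 1) := Fin.snoc (α := fun _ => SignType) x (-1)

def mu {n : ℕ} (x : Word n) : Word (n + 1) := Fin.snoc (α := fun _ => SignType) x 0

def nu {n : ℕ} (x : Word n) : Word (n + 1) := Fin.snoc (α := fun _ => SignType) x 1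

/-- The source `k`-face `ψ_k[n]`, as a set of words. -/
def psi : (k n : ℕ) → Finset (Word n)
  | 0, _ => {fun _ => -1}
  | _ + 1, 0 => {fun _ => 0}
  | k + 1, n + 1 =>
      if n + 1 ≤ k + 1 then {fun _ => 0}
      else if Even (k + 1) then (psi k n).image mu ∪ (psi (k + 1) n).image lam
      else (psi k n).image mu ∪ (psi (k + 1) n).image nu

/-- The target `k`-face `ω_k[n]`, as a set of words. -/
def omega : (k n : ℕ) → Finset (Word n)
  | 0, _ => {fun _ => 1}
  | _ + 1, 0 => {fun _ => 0}
  | k + 1, n + 1 =>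
      if n + 1 ≤ k + 1 then {fun _ => 0}
      else if Even (k + 1) then (omega (k + 1) n).image nu ∪ (omega k n).image mu
      else (omega (k + 1) n).image lam ∪ (omega k n).image mu

/-- The closed geometric sub-cube of `[-1, 1]ⁿ` that a word describes. -/
def cell {n : ℕ} (x : Word n) : Set (Fin n → ℝ) :=
  {p | ∀ i, (x i = 0 → p i ∈ Set.Icc (-1 : ℝ) 1) ∧ (x i ≠ 0 → p i = (x i : ℝ))}

/-- The boundary of the geometric sub-cube: the points that lie on one of its proper faces. -/
def cellBoundary {n : ℕ} (x : Word n) : Set (Fin n → ℝ) :=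
  {p | p ∈ cell x ∧ ∃ i, x i = 0 ∧ (p i = -1 ∨ p i = 1)}

/-- The disjoint union of the geometric sub-cubes in a set `A` of words. -/
abbrev Pieces {n : ℕ} (A : Finset (Word n)) : Type :=
  Σ x : {x : Word n // x ∈ A}, {p : Fin n → ℝ // p ∈ cell x.1}

/-- A boundary point of one piece is identified with a boundary point of another
when they are the same point of the `n`-cube. -/
def GlueRel {n : ℕ} (A : Finset (Word n)) (a b : Pieces A) : Prop :=
  a.2.1 = b.2.1 ∧ a.2.1 ∈ cellBoundary a.1.1 ∧ b.2.1 ∈ cellBoundary b.1.1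

/-- The elements of `A`, identified along common boundaries, with the quotient topology. -/
abbrev Glued {n : ℕ} (A : Finset (Word n)) : Type := Quot (GlueRel A)

/-- The natural map from the glued space to the `n`-cube. -/
def Glued.toCube {n : ℕ} (A : Finset (Word n)) : Glued A → (Fin n → ℝ) :=
  Quot.lift (fun a => a.2.1) (fun _ _ h => h.1)

/-- The points of the `n`-cube that lie on an element of `A`. -/
def carrier {n : ℕ} (A : Finset (Word n)) : Set (Fin n → ℝ) := {p | ∃ x ∈ A, p ∈ cell x}

/-- The standard closed `k`-disk. -/
abbrev Disk (k : ℕ) : Type := {v : EuclideanSpace ℝ (Fin k) // ‖v‖ ≤ 1}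

/-- The boundary sphere of the standard closed `k`-disk. -/
def diskBoundary (k : ℕ) : Set (Disk k) := {v | ‖v.1‖ = 1}

end OrientedCube

namespace OrientedCube

open Finset Polynomial

/-! With decreasing parameters t_i, `momentMap n k` sends x to the moments ∑ x_i t_i^m, m < k, and
the cube to a zonotope Z, a convex body in ℝ^k. The set |ψ_k[n]| consists of the points of the cube
that minimise the next moment ∑ x_i t_i^k on their fibre, and |ω_k[n]| = -|ψ_k[n]| of those that
maximise it. Both are therefore sections over Z, which makes the glued space a disk.

Words of `psi` carry the signs of monic polynomials with roots at their free coordinates; comparing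
two such polynomials gives injectivity (`momentMap_injOn_carrier_psi`). Independently of words, the
carrier of `psi` is described by a forbidden alternation (`mem_carrier_psi`). An alternation permits
a perturbation along a divided difference that lowers the next moment, so fibrewise minimisers lie
in the carrier (`momentMap_image_carrier_psi`). The same divided differences show that a supporting
functional of Z exists exactly over the carriers one dimension lower (`mem_frontier_iff`). -/

/-- The parameter of the `i`-th coordinate on the moment curve; parameters decrease with `i`. -/
def node {n : ℕ} (i : Fin n) : ℝ := -(i : ℝ)

/-- The free coordinates of a word. -/
def zeros {n : ℕ} (w : Word n) : Finset (Fin n) := univ.filter (w · = 0)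

/-- `x` avoids the values `-1, 1, -1, …` in turn along some `k + 1` increasing positions. -/
def HasAlternation {n : ℕ} (k : ℕ) (x : Fin n → ℝ) : Prop :=
  ∃ i : Fin (k + 1) → Fin n, StrictMono i ∧ ∀ j, x (i j) ≠ -(-1) ^ (j : ℕ)

/-! ### Cells, carriers and the recursion; `omega` as the negative of `psi` -/

lemma mem_zeros {n : ℕ} {w : Word n} {i : Fin n} : i ∈ zeros w ↔ w i = 0 := by simp [zeros]

lemma node_castSucc {n : ℕ} (i : Fin n) : node i.castSucc = node i := by simp [node]

lemma node_strictAnti {n : ℕ} : StrictAnti (node (n := n)) := fun i j h => by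
  simpa [node] using h

lemma cell_subset_Icc {n : ℕ} (w : Word n) : cell w ⊆ Set.Icc (-1) 1 := by
  intro p hp
  have h : ∀ i, -1 ≤ p i ∧ p i ≤ 1 := fun i => by
    by_cases h0 : w i = 0
    · exact (hp i).1 h0
    · rw [(hp i).2 h0]
      cases w i <;> norm_num
  exact ⟨fun i => (h i).1, fun i => (h i).2⟩

lemma cell_zero {n : ℕ} : cell (fun _ : Fin n => (0 : SignType)) = Set.Icc (-1) 1 := by
  refine (cell_subset_Icc _).antisymm fun p hp i => ⟨fun _ => ⟨hp.1 i, hp.2 i⟩, fun h => ?_⟩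
  exact absurd rfl h

lemma mem_cell_snoc {n : ℕ} (w : Word n) (s : SignType) (p : Fin (n + 1) → ℝ) :
    p ∈ cell (Fin.snoc (α := fun _ => SignType) w s : Word (n + 1)) ↔
      Fin.init p ∈ cell w ∧ (s = 0 → p (Fin.last n) ∈ Set.Icc (-1 : ℝ) 1) ∧
        (s ≠ 0 → p (Fin.last n) = s) := by
  simp only [cell, Set.mem_ofPred_eq, Fin.forall_fin_succ', Fin.snoc_castSucc, Fin.snoc_last,
    Fin.init]

lemma carrier_union {n : ℕ} (A B : Finset (Word n)) :
    carrier (A ∪ B) = carrier A ∪ carrier B := by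
  ext p
  simp only [carrier, mem_union, Set.mem_ofPred_eq, Set.mem_union, or_and_right, exists_or]

lemma mem_carrier_image_snoc {n : ℕ} (A : Finset (Word n)) (s : SignType)
    (p : Fin (n + 1) → ℝ) :
    p ∈ carrier (A.image fun w => (Fin.snoc (α := fun _ => SignType) w s : Word (n + 1))) ↔
      Fin.init p ∈ carrier A ∧ (s = 0 → p (Fin.last n) ∈ Set.Icc (-1 : ℝ) 1) ∧
        (s ≠ 0 → p (Fin.last n) = s) := by
  simp only [carrier, Set.mem_ofPred_eq, Finset.mem_image, exists_exists_and_eq_and, mem_cell_snoc,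
    ← and_assoc, exists_and_right]

lemma psi_succ_succ {k n : ℕ} (h : k < n) :
    psi (k + 1) (n + 1) =
      (psi k n).image (fun w => (Fin.snoc (α := fun _ => SignType) w 0 : Word (n + 1))) ∪
      (psi (k + 1) n).image
        (fun w => (Fin.snoc (α := fun _ => SignType) w ((-1) ^ k) : Word (n + 1))) := by
  rw [psi, if_neg (by omega)]
  by_cases hk : Even k
  · rw [if_neg (by simpa [Nat.even_add_one] using hk), hk.neg_one_pow]
    rfl
  · rw [if_pos (by simpa [Nat.even_add_one] using hk), (Nat.not_even_iff_odd.1 hk).neg_one_pow]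
    rfl

lemma psi_of_le {k n : ℕ} (hk : 1 ≤ k) (h : n ≤ k) : psi k n = {fun _ => 0} := by
  obtain ⟨k, rfl⟩ := Nat.exists_eq_add_of_le' hk
  cases n with
  | zero => rfl
  | succ n => rw [psi, if_pos h]

lemma image_neg_snoc {n : ℕ} (A : Finset (Word n)) (s : SignType) :
    (A.image fun w => (Fin.snoc (α := fun _ => SignType) w s : Word (n + 1))).image (fun w => -w) =
      (A.image fun w => -w).image
        fun w => (Fin.snoc (α := fun _ => SignType) w (-s) : Word (n + 1)) := by
  simp only [Finset.image_image]
  congr 1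
  ext w i
  refine Fin.lastCases ?_ (fun i => ?_) i <;> simp

lemma omega_eq_image_neg (k n : ℕ) : omega k n = (psi k n).image (fun w => -w) := by
  induction n generalizing k with
  | zero =>
    cases k with
    | zero => simp only [omega, psi, image_singleton]; congr 1
    | succ k => simp only [omega, psi, image_singleton]; congr 1
  | succ n ih =>
    cases k with
    | zero => simp only [omega, psi, image_singleton]; congr 1
    | succ k =>
      rw [omega]
      split_ifs with h1 h2
      · rw [psi_of_le (by omega) h1, image_singleton]
        congr 1
      · have hk : Odd k := by simpa [Nat.even_add_one] using h2
        rw [psi_succ_succ (by omega), image_union, image_neg_snoc, image_neg_snoc, ih, ih,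
          hk.neg_one_pow, union_comm]
        simp only [neg_neg, neg_zero]
        rfl
      · have hk : Even k := by simpa [Nat.even_add_one] using h2
        rw [psi_succ_succ (by omega), image_union, image_neg_snoc, image_neg_snoc, ih, ih,
          hk.neg_one_pow, union_comm]
        simp only [neg_zero]
        rfl

lemma mem_cell_neg {n : ℕ} (w : Word n) (p : Fin n → ℝ) : p ∈ cell (-w) ↔ -p ∈ cell w := by
  refine forall_congr' fun i => ?_
  simp only [Pi.neg_apply, Set.mem_Icc]
  have h0 : -w i = 0 ↔ w i = 0 := by cases w i <;> decide
  have h1 : ((-w i : SignType) : ℝ) = -(w i : ℝ) := by cases w i <;> norm_num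
  rw [h0, neg_le_neg_iff, neg_le, h1, neg_eq_iff_eq_neg, and_comm (a := p i ≤ 1)]
  exact and_congr Iff.rfl (imp_congr (not_congr h0) Iff.rfl)

lemma mem_carrier_omega {k n : ℕ} {p : Fin n → ℝ} :
    p ∈ carrier (omega k n) ↔ -p ∈ carrier (psi k n) := by
  simp [carrier, omega_eq_image_neg, mem_cell_neg]

/-! ### Alternations and the carrier of `psi` -/

lemma hasAlternation_zero {n : ℕ} {x : Fin n → ℝ} : HasAlternation 0 x ↔ ∃ i, x i ≠ -1 := by
  constructor
  · rintro ⟨i, -, h⟩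
    exact ⟨i 0, by simpa using h 0⟩
  · rintro ⟨i, h⟩
    exact ⟨fun _ => i, Subsingleton.strictMono (α := Fin 1) _, fun j => by simpa using h⟩

lemma HasAlternation.of_succ {n k : ℕ} {x : Fin n → ℝ} (h : HasAlternation (k + 1) x) :
    HasAlternation k x := by
  obtain ⟨i, hi, h⟩ := h
  exact ⟨i ∘ Fin.castSucc, hi.comp Fin.strictMono_castSucc, fun j => by simpa using h j.castSucc⟩

lemma HasAlternation.neg_of_succ {n k : ℕ} {x : Fin n → ℝ} (h : HasAlternation (k + 1) x) :
    HasAlternation k (-x) := by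
  obtain ⟨i, hi, h⟩ := h
  refine ⟨i ∘ Fin.succ, hi.comp Fin.strictMono_succ, fun j => ?_⟩
  have := h j.succ
  rw [Fin.val_succ, pow_succ, mul_neg_one, neg_neg] at this
  simpa using this

lemma HasAlternation.lt {n k : ℕ} {x : Fin n → ℝ} (h : HasAlternation k x) : k < n := by
  obtain ⟨i, hi, -⟩ := h
  simpa using Fintype.card_le_of_injective i hi.injective

/-- The cases are whether the last chosen position is the last coordinate; there the value to avoid
is -(-1)^(k+1) = (-1)^k. -/
lemma hasAlternation_succ_iff {n k : ℕ} {x : Fin (n + 1) → ℝ} :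
    HasAlternation (k + 1) x ↔ HasAlternation (k + 1) (Fin.init x) ∨
      (HasAlternation k (Fin.init x) ∧ x (Fin.last n) ≠ (-1) ^ k) := by
  constructor
  · rintro ⟨i, hi, h⟩
    have hlt : ∀ j, j < Fin.last (k + 1) → i j ≠ Fin.last n := fun j hj =>
      ((hi hj).trans_le (Fin.le_last _)).ne
    by_cases hl : i (Fin.last _) = Fin.last n
    · right
      refine ⟨⟨fun j => (i j.castSucc).castPred (hlt _ (Fin.castSucc_lt_last j)), ?_, ?_⟩, ?_⟩
      · intro a b hab
        simpa using hi (Fin.castSucc_lt_castSucc_iff.2 hab)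
      · intro j
        simpa [Fin.init] using h j.castSucc
      · have := h (Fin.last _)
        rwa [hl, Fin.val_last, pow_succ, mul_neg_one, neg_neg] at this
    · left
      have hne : ∀ j, i j ≠ Fin.last n := fun j => by
        rcases eq_or_ne j (Fin.last _) with rfl | hj
        · exact hl
        · exact hlt j (Fin.lt_last_iff_ne_last.2 hj)
      refine ⟨fun j => (i j).castPred (hne j), ?_, fun j => ?_⟩
      · intro a b hab
        simpa using hi hab
      · simpa [Fin.init] using h j
  · rintro (⟨i, hi, h⟩ | ⟨⟨i, hi, h⟩, hl⟩)
    · exact ⟨fun j => (i j).castSucc, fun a b hab => by simpa using hi hab, h⟩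
    · refine ⟨Fin.snoc (α := fun _ => Fin (n + 1)) (fun j => (i j).castSucc) (Fin.last n), ?_, ?_⟩
      · intro a b
        refine Fin.lastCases ?_ (fun b => ?_) b
        · refine Fin.lastCases (fun hab => absurd hab (lt_irrefl _)) (fun a _ => ?_) a
          simp
        · refine Fin.lastCases (fun hab => ?_) (fun a hab => ?_) a
          · exact absurd hab (Fin.le_last _).not_gt
          · simpa using hi (Fin.castSucc_lt_castSucc_iff.1 hab)
      · intro j
        refine Fin.lastCases ?_ (fun j => ?_) j
        · simpa [pow_succ] using hl
        · simpa [Fin.init] using h j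

lemma mem_Icc_succ_iff {n : ℕ} {x : Fin (n + 1) → ℝ} :
    x ∈ Set.Icc (-1) 1 ↔ Fin.init x ∈ Set.Icc (-1) 1 ∧ x (Fin.last n) ∈ Set.Icc (-1 : ℝ) 1 := by
  simp only [Set.mem_Icc, Pi.le_def, Fin.forall_fin_succ', Fin.init, Pi.neg_apply, Pi.one_apply]
  tauto

/-- The recursions for `psi` and for alternations agree: the appended symbol of `psi (k + 1)` is
free over `psi k`, and otherwise equals the one value that cannot extend an alternation. -/
lemma mem_carrier_psi {n k : ℕ} {x : Fin n → ℝ} :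
    x ∈ carrier (psi k n) ↔ x ∈ Set.Icc (-1) 1 ∧ ¬ HasAlternation k x := by
  induction n generalizing k with
  | zero =>
    have : ¬ HasAlternation k x := fun h => absurd h.lt (Nat.not_lt_zero _)
    have h0 : x ∈ Set.Icc (-1) 1 := ⟨fun i => i.elim0, fun i => i.elim0⟩
    have h1 : x ∈ carrier (psi k 0) := by
      cases k <;> exact ⟨_, mem_singleton_self _, fun i => i.elim0⟩
    tauto
  | succ n ih =>
    cases k with
    | zero =>
      rw [hasAlternation_zero]
      push Not
      simp only [psi, carrier, mem_singleton, exists_eq_left, Set.mem_ofPred_eq]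
      constructor
      · intro h
        exact ⟨cell_subset_Icc _ h, fun i => by simpa using (h i).2 (show (-1 : SignType) ≠ 0 by decide)⟩
      · rintro ⟨-, h⟩ i
        exact ⟨fun h0 => absurd h0 (show (-1 : SignType) ≠ 0 by decide), fun _ => by simpa using h i⟩
    | succ k =>
      rcases le_or_gt n k with h | h
      · have : ¬ HasAlternation (k + 1) x := fun h' => by have := h'.lt; omega
        rw [psi_of_le (by omega) (by omega)]
        simp [carrier, this, cell_zero]
      · rw [psi_succ_succ h, carrier_union, Set.mem_union, mem_carrier_image_snoc,
          mem_carrier_image_snoc, ih, ih, hasAlternation_succ_iff, mem_Icc_succ_iff]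
        have hs : ((-1) ^ k : SignType) ≠ 0 := by
          rcases neg_one_pow_eq_or SignType k with h | h <;> rw [h] <;> decide
        have hc : (((-1) ^ k : SignType) : ℝ) = (-1) ^ k := by
          rcases Nat.even_or_odd k with h | h <;> simp [h.neg_one_pow]
        have hI : x (Fin.last n) = (-1) ^ k → x (Fin.last n) ∈ Set.Icc (-1 : ℝ) 1 := by
          intro h
          rcases neg_one_pow_eq_or ℝ k with h' | h' <;> rw [h, h'] <;> norm_num
        have hm := HasAlternation.of_succ (k := k) (x := Fin.init x)
        rw [hc]
        simp only [hs, ne_eq, not_true_eq_false, not_false_eq_true, forall_true_left, false_imp_iff,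
          and_true, true_and]
        tauto

lemma carrier_psi_subset_Icc {n k : ℕ} : carrier (psi k n) ⊆ Set.Icc (-1) 1 :=
  fun _ h => (mem_carrier_psi.1 h).1

/-! ### Sign pattern of the words of `psi` -/

lemma card_zeros_snoc {n : ℕ} (w : Word n) (s : SignType) :
    #(zeros (Fin.snoc (α := fun _ => SignType) w s : Word (n + 1))) =
      #(zeros w) + if s = 0 then 1 else 0 := by
  simp only [zeros, Finset.card_filter, Fin.sum_univ_castSucc, Fin.snoc_castSucc, Fin.snoc_last]

lemma prod_zeros_snoc {n : ℕ} (w : Word n) (s : SignType) (t : ℝ) :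
    ∏ l ∈ zeros (Fin.snoc (α := fun _ => SignType) w s : Word (n + 1)), (t - node l) =
      (∏ l ∈ zeros w, (t - node l)) * if s = 0 then t - node (Fin.last n) else 1 := by
  simp only [zeros, Finset.prod_filter, Fin.prod_univ_castSucc, Fin.snoc_castSucc, Fin.snoc_last,
    node_castSucc]

lemma sign_prod_last {n : ℕ} (w : Word n) :
    SignType.sign (∏ l ∈ zeros w, (node (Fin.last n) - node l)) = (-1) ^ #(zeros w) := by
  rw [← Finset.prod_const, ← signHom_apply, map_prod]
  refine Finset.prod_congr rfl fun l _ => ?_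
  rw [signHom_apply, sign_eq_neg_one_iff, sub_neg, ← node_castSucc]
  exact node_strictAnti (Fin.castSucc_lt_last l)

lemma psi_word_spec {n k : ℕ} (hk : k ≤ n) {w : Word n} (hw : w ∈ psi k n) :
    #(zeros w) = k ∧ ∀ i, w i = -SignType.sign (∏ l ∈ zeros w, (node i - node l)) := by
  induction n generalizing k with
  | zero =>
    obtain rfl : k = 0 := by omega
    exact ⟨by simp [zeros], fun i => i.elim0⟩
  | succ n ih =>
    cases k with
    | zero =>
      obtain rfl : w = fun _ => -1 := by simpa [psi] using hw
      have : zeros (fun _ : Fin (n + 1) => (-1 : SignType)) = ∅ := by simp [zeros]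
      simp [this]
    | succ k =>
      rcases Nat.eq_or_lt_of_le hk with h | h
      · obtain rfl : w = fun _ => 0 := by simpa [psi_of_le (by omega) h.ge] using hw
        have hz : zeros (fun _ : Fin (n + 1) => (0 : SignType)) = univ := by simp [zeros]
        rw [hz]
        refine ⟨by simp [h], fun i => ?_⟩
        rw [Finset.prod_eq_zero (mem_univ i) (sub_self _), sign_zero]
        rfl
      · rw [psi_succ_succ (by omega), mem_union, mem_image, mem_image] at hw
        rcases hw with ⟨v, hv, rfl⟩ | ⟨v, hv, rfl⟩
        · obtain ⟨hc, hs⟩ := ih (by omega) hv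
          refine ⟨by simp [card_zeros_snoc, hc], fun i => ?_⟩
          rw [prod_zeros_snoc, if_pos rfl]
          refine Fin.lastCases ?_ (fun i => ?_) i
          · simp
          -- The new coordinate has the smallest parameter, so the factor of a new root is positive
          -- at all earlier nodes and leaves their signs unchanged.
          · have hpos : 0 < node i.castSucc - node (Fin.last n) :=
              sub_pos.2 (node_strictAnti (Fin.castSucc_lt_last i))
            rw [Fin.snoc_castSucc, sign_mul, sign_pos hpos, mul_one, node_castSucc]
            exact hs i
        · obtain ⟨hc, hs⟩ := ih (by omega) hv
          have h0 : ((-1) ^ k : SignType) ≠ 0 := by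
            rcases neg_one_pow_eq_or SignType k with h | h <;> rw [h] <;> decide
          refine ⟨by simp [card_zeros_snoc, hc, h0], fun i => ?_⟩
          rw [prod_zeros_snoc, if_neg h0, mul_one]
          refine Fin.lastCases ?_ (fun i => ?_) i
          · rw [Fin.snoc_last, sign_prod_last, hc, pow_succ, mul_neg_one, neg_neg]
          · rw [Fin.snoc_castSucc, node_castSucc]
            exact hs i

/-! ### The moment map, supporting polynomials and divided differences -/

/-- The linear map sending the `i`-th basis vector to a point of the moment curve. -/
noncomputable def momentMap (n k : ℕ) : (Fin n → ℝ) →ₗ[ℝ] EuclideanSpace ℝ (Fin k) where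
  toFun x := WithLp.toLp 2 fun m => ∑ i, x i * node i ^ (m : ℕ)
  map_add' x y := by ext m; simp [add_mul, Finset.sum_add_distrib]
  map_smul' c x := by ext m; simp [mul_assoc, Finset.mul_sum]

/-- The polynomial with given coefficients. -/
noncomputable def coeffPoly {k : ℕ} (c : EuclideanSpace ℝ (Fin k)) : ℝ[X] :=
  ∑ m : Fin k, C (c m) * X ^ (m : ℕ)

/-- The pairing of `y` with the values of `r` at the nodes is minimal over the cube at `y = x`. -/
def Supports {n : ℕ} (r : ℝ[X]) (x : Fin n → ℝ) : Prop :=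
  ∀ i, x i * r.eval (node i) = -|r.eval (node i)|

lemma momentMap_apply {n k : ℕ} (x : Fin n → ℝ) (m : Fin k) :
    momentMap n k x m = ∑ i, x i * node i ^ (m : ℕ) := rfl

lemma inner_momentMap {n k : ℕ} (c : EuclideanSpace ℝ (Fin k)) (x : Fin n → ℝ) :
    inner ℝ c (momentMap n k x) = ∑ i, x i * (coeffPoly c).eval (node i) := by
  simp only [PiLp.inner_apply, momentMap_apply, coeffPoly, eval_finsetSum, eval_mul, eval_C,
    eval_pow, eval_X, Finset.mul_sum, RCLike.inner_apply, conj_trivial, Finset.sum_mul]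
  rw [Finset.sum_comm]
  exact Finset.sum_congr rfl fun i _ => Finset.sum_congr rfl fun m _ => by ring

lemma degree_coeffPoly_lt {k : ℕ} (c : EuclideanSpace ℝ (Fin k)) : (coeffPoly c).degree < k :=
  degree_sum_fin_lt _

lemma coeffPoly_eq_of_degree_lt {k : ℕ} {r : ℝ[X]} (hr : r.degree < k) :
    coeffPoly (WithLp.toLp 2 fun m : Fin k => r.coeff m) = r := by
  rw [coeffPoly]
  have := Fin.sum_univ_eq_sum_range (fun m => C (r.coeff m) * X ^ m) k
  rw [this]
  rcases eq_or_ne r 0 with rfl | h0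
  · simp
  · exact (r.as_sum_range_C_mul_X_pow' ((natDegree_lt_iff_degree_lt h0).2 hr)).symm

lemma coeffPoly_ne_zero {k : ℕ} {c : EuclideanSpace ℝ (Fin k)} (hc : c ≠ 0) :
    coeffPoly c ≠ 0 := by
  contrapose! hc
  ext m
  have := congrArg (fun p => p.coeff (m : ℕ)) hc
  simpa [coeffPoly, coeff_X_pow, Fin.val_inj] using this

lemma sum_eval_eq_of_momentMap_eq {n k : ℕ} {x y : Fin n → ℝ}
    (h : momentMap n k x = momentMap n k y) {r : ℝ[X]} (hr : r.degree < k) :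
    ∑ i, x i * r.eval (node i) = ∑ i, y i * r.eval (node i) := by
  rw [← coeffPoly_eq_of_degree_lt hr, ← inner_momentMap, ← inner_momentMap, h]

lemma Supports.le {n : ℕ} {r : ℝ[X]} {x y : Fin n → ℝ} (h : Supports r x)
    (hy : y ∈ Set.Icc (-1) 1) (i : Fin n) :
    x i * r.eval (node i) ≤ y i * r.eval (node i) := by
  rw [h i]
  have h1 : |y i| ≤ 1 := abs_le.2 ⟨hy.1 i, hy.2 i⟩
  have h2 : |y i * r.eval (node i)| ≤ |r.eval (node i)| := by
    rw [abs_mul]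
    exact mul_le_of_le_one_left (abs_nonneg _) h1
  exact (abs_le.1 h2).1

lemma eq_zero_of_eval_node_eq_zero {n m : ℕ} {r : ℝ[X]} (hr : r.degree < m)
    {i : Fin m → Fin n} (hi : StrictMono i) (h : ∀ j, r.eval (node (i j)) = 0) : r = 0 := by
  refine eq_zero_of_degree_lt_of_eval_index_eq_zero (s := univ) (v := fun j => node (i j))
    (fun a _ b _ hab => hi.injective (node_strictAnti.injective hab)) ?_ fun j _ => h j
  simpa using hr

/-- Divided differences along increasing positions: the weights alternate in sign. -/
lemma exists_dividedDifference {n m : ℕ} {i : Fin (m + 1) → Fin n} (hi : StrictMono i) :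
    ∃ w : Fin (m + 1) → ℝ, (∀ j : Fin (m + 1), 0 < (-1) ^ (j : ℕ) * w j) ∧
      ∀ r : ℝ[X], r.degree < (m + 1 : ℕ) → r.coeff m = ∑ j, w j * r.eval (node (i j)) := by
  refine ⟨fun j => (∏ l ∈ univ.erase j, (node (i j) - node (i l)))⁻¹, fun j => ?_, fun r hr => ?_⟩
  -- The nodes decrease, so the negative factors are the j ones with l < j.
  · have hp : (-1 : ℝ) ^ (j : ℕ) = ∏ l ∈ univ.erase j, if l < j then (-1 : ℝ) else 1 := by
      rw [Finset.prod_ite, Finset.prod_const_one, mul_one, Finset.prod_const]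
      congr 1
      have : (univ.erase j).filter (· < j) = Iio j := by
        ext l
        simp only [mem_filter, mem_erase, mem_univ, and_true, mem_Iio, and_iff_right_iff_imp]
        exact fun h => h.ne
      rw [this, Fin.card_Iio]
    have key : 0 < (-1 : ℝ) ^ (j : ℕ) * ∏ l ∈ univ.erase j, (node (i j) - node (i l)) := by
      rw [hp, ← Finset.prod_mul_distrib]
      refine Finset.prod_pos fun l hl => ?_
      split_ifs with h
      · have := node_strictAnti (hi h)
        linarith
      · have := node_strictAnti (hi (lt_of_le_of_ne (not_lt.1 h) (ne_of_mem_erase hl).symm))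
        linarith
    rcases neg_one_pow_eq_or ℝ (j : ℕ) with h | h
    · rw [h, one_mul] at key ⊢
      exact inv_pos.2 key
    · rw [h, neg_one_mul, neg_pos] at key ⊢
      exact inv_lt_zero.2 key
  · have := Lagrange.coeff_eq_sum (s := univ) (v := fun j => node (i j))
      (fun a _ b _ hab => hi.injective (node_strictAnti.injective hab)) (P := r) (by simpa using hr)
    simp only [card_univ, Fintype.card_fin, Nat.add_sub_cancel] at this
    rw [this]
    exact Finset.sum_congr rfl fun j _ => div_eq_inv_mul _ _

/-! ### The moment map is injective on the carrier of `psi` -/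

/-- The monic polynomial vanishing at the nodes of the free coordinates of a word. -/
noncomputable def wordPoly {n : ℕ} (w : Word n) : ℝ[X] := Lagrange.nodal (zeros w) node

lemma eval_wordPoly {n : ℕ} (w : Word n) (t : ℝ) :
    (wordPoly w).eval t = ∏ l ∈ zeros w, (t - node l) := Lagrange.eval_nodal

lemma supports_wordPoly {n k : ℕ} (hk : k ≤ n) {w : Word n} (hw : w ∈ psi k n) {x : Fin n → ℝ}
    (hx : x ∈ cell w) : Supports (wordPoly w) x := by
  intro i
  by_cases h0 : w i = 0
  · have : (wordPoly w).eval (node i) = 0 := Lagrange.eval_nodal_at_node (mem_zeros.2 h0)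
    simp [this]
  · rw [(hx i).2 h0, (psi_word_spec hk hw).2 i, ← eval_wordPoly]
    rcases lt_trichotomy ((wordPoly w).eval (node i)) 0 with h | h | h
    · simp [sign_neg h, abs_of_neg h]
    · simp [h]
    · simp [sign_pos h, abs_of_pos h]

lemma degree_wordPoly {n k : ℕ} (hk : k ≤ n) {w : Word n} (hw : w ∈ psi k n) :
    (wordPoly w).degree = k := by
  rw [wordPoly, Lagrange.degree_nodal, (psi_word_spec hk hw).1]

lemma wordPoly_monic {n : ℕ} (w : Word n) : (wordPoly w).Monic := Lagrange.nodal_monic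

lemma momentMap_injOn_carrier_psi {n k : ℕ} (hk : k ≤ n) :
    Set.InjOn (momentMap n k) (carrier (psi k n)) := by
  rintro x ⟨v, hv, hx⟩ y ⟨w, hw, hy⟩ hxy
  -- Both polynomials are monic of degree k, so x and y pair equally with their difference. As x
  -- minimises the pairing with `wordPoly v` and y that with `wordPoly w`, both inequalities become
  -- equalities.
  have hdeg : (wordPoly v - wordPoly w).degree < k := by
    have := degree_sub_lt_left (p := wordPoly v) (q := wordPoly w)
      (by rw [degree_wordPoly hk hv, degree_wordPoly hk hw]) (wordPoly_monic v).ne_zero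
      (by rw [(wordPoly_monic v).leadingCoeff, (wordPoly_monic w).leadingCoeff])
    rwa [degree_wordPoly hk hv] at this
  have hs := sum_eval_eq_of_momentMap_eq hxy hdeg
  simp only [eval_sub, mul_sub, Finset.sum_sub_distrib] at hs
  have hle1 := (supports_wordPoly hk hv hx).le (cell_subset_Icc _ hy)
  have hle2 := (supports_wordPoly hk hw hy).le (cell_subset_Icc _ hx)
  have heq : ∑ i, x i * (wordPoly v).eval (node i) = ∑ i, y i * (wordPoly v).eval (node i) := by
    have h1 := Finset.sum_le_sum fun i (_ : i ∈ univ) => hle1 i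
    have h2 := Finset.sum_le_sum fun i (_ : i ∈ univ) => hle2 i
    linarith
  have hall := (Finset.sum_eq_sum_iff_of_le fun i _ => hle1 i).1 heq
  have hoff : ∀ i, i ∉ zeros v → x i = y i := fun i hi => by
    refine mul_right_cancel₀ ?_ (hall i (mem_univ i))
    exact Lagrange.eval_nodal_not_at_node
      fun l hl h => hi (by rwa [node_strictAnti.injective h])
  funext i
  by_cases hi : i ∈ zeros v
  -- This polynomial vanishes at every free node of v except the i-th, so it isolates x i - y i.
  · set r : ℝ[X] := Lagrange.nodal ((zeros v).erase i) node
    have hr : r.degree < k := by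
      rw [Lagrange.degree_nodal, ← (psi_word_spec hk hv).1]
      exact_mod_cast Finset.card_erase_lt_of_mem hi
    have h := sum_eval_eq_of_momentMap_eq hxy hr
    rw [← sub_eq_zero, ← Finset.sum_sub_distrib, Finset.sum_eq_single i] at h
    · rw [← sub_mul, mul_eq_zero] at h
      refine sub_eq_zero.1 (h.resolve_right ?_)
      exact Lagrange.eval_nodal_not_at_node
        fun l hl h => (mem_erase.1 hl).1 (node_strictAnti.injective h).symm
    · intro l _ hl
      by_cases hlz : l ∈ zeros v
      · have : r.eval (node l) = 0 := Lagrange.eval_nodal_at_node (mem_erase.2 ⟨hl, hlz⟩)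
        simp [this]
      · rw [hoff l hlz, sub_self]
    · simp
  · exact hoff i hi

/-! ### Fibrewise minimisation: the carrier of `psi` covers the zonotope -/

/-- An alternation of length `k + 1` allows moving inside the fibre of the moment map while
decreasing the next moment. -/
lemma HasAlternation.exists_decrease {n k : ℕ} {x : Fin n → ℝ} (hx : x ∈ Set.Icc (-1) 1)
    (h : HasAlternation k x) :
    ∃ y ∈ Set.Icc (-1 : Fin n → ℝ) 1, momentMap n k y = momentMap n k x ∧
      ∑ l, y l * node l ^ k < ∑ l, x l * node l ^ k := by
  obtain ⟨i, hi, h⟩ := h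
  obtain ⟨w, hw, hr⟩ := exists_dividedDifference hi
  let d : Fin n → ℝ := fun l => ∑ j, if i j = l then w j else 0
  have hd : ∀ m, ∑ l, d l * node l ^ m = ∑ j, w j * node (i j) ^ m := fun m => by
    simp only [d, Finset.sum_mul, ite_mul, zero_mul]
    rw [Finset.sum_comm]
    simp
  have hdi : ∀ j, d (i j) = w j := fun j => by
    simp [d, hi.injective.eq_iff]
  have hd0 : ∀ l, (∀ j, i j ≠ l) → d l = 0 := fun l hl => by
    simp [d, hl]
  -- The weight at the j-th position has sign (-1)^j, and x avoids just the endpoint towards which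
  -- subtracting it moves.
  have hsmall : ∀ l, ∀ᶠ δ in nhdsWithin (0 : ℝ) (Set.Ioi 0), x l - δ * d l ∈ Set.Icc (-1 : ℝ) 1 := by
    intro l
    by_cases hl : ∃ j, i j = l
    · obtain ⟨j, rfl⟩ := hl
      have hc : Filter.Tendsto (fun δ : ℝ => x (i j) - δ * d (i j)) (nhdsWithin 0 (Set.Ioi 0))
          (nhds (x (i j))) := by
        have : Continuous fun δ : ℝ => x (i j) - δ * d (i j) := by fun_prop
        simpa using (this.tendsto 0).mono_left nhdsWithin_le_nhds
      have hwj := hw j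
      have hj := h j
      rw [← hdi] at hwj
      rcases neg_one_pow_eq_or ℝ (j : ℕ) with h1 | h1
      · rw [h1] at hj hwj
        have hgt : -1 < x (i j) := lt_of_le_of_ne (hx.1 _) (Ne.symm hj)
        filter_upwards [hc.eventually (lt_mem_nhds hgt), self_mem_nhdsWithin] with δ h2 h3
        have := mul_pos (Set.mem_Ioi.1 h3) (one_mul (d (i j)) ▸ hwj)
        have hx2 : x (i j) ≤ 1 := hx.2 _
        exact ⟨h2.le, by linarith⟩
      · rw [h1] at hj hwj
        have hgt : x (i j) < 1 := lt_of_le_of_ne (hx.2 _) (by simpa using hj)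
        filter_upwards [hc.eventually (gt_mem_nhds hgt), self_mem_nhdsWithin] with δ h2 h3
        have := mul_pos (Set.mem_Ioi.1 h3) (neg_one_mul (d (i j)) ▸ hwj)
        have hx2 : -1 ≤ x (i j) := hx.1 _
        exact ⟨by linarith, h2.le⟩
    · refine Filter.Eventually.of_forall fun δ => ?_
      rw [hd0 l (by simpa using hl)]
      simpa using ⟨hx.1 l, hx.2 l⟩
  obtain ⟨δ, hδ, hpos⟩ := ((Filter.eventually_all.2 hsmall).and self_mem_nhdsWithin).exists
  -- The divided difference of X^m is its k-th coefficient: 0 for m < k and 1 for m = k.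
  have hmom : ∀ m ≤ k, ∑ l, (x l - δ * d l) * node l ^ m =
      ∑ l, x l * node l ^ m - δ * (X ^ m : ℝ[X]).coeff k := fun m hm => by
    rw [hr (X ^ m) (by rw [degree_X_pow]; exact_mod_cast Nat.lt_succ_of_le hm)]
    simp only [eval_pow, eval_X]
    rw [← hd, Finset.mul_sum, ← Finset.sum_sub_distrib]
    exact Finset.sum_congr rfl fun l _ => by ring
  refine ⟨fun l => x l - δ * d l, ⟨fun l => (hδ l).1, fun l => (hδ l).2⟩, ?_, ?_⟩
  · ext m
    rw [momentMap_apply, momentMap_apply, hmom m m.2.le, coeff_X_pow, if_neg m.2.ne']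
    simp
  · rw [hmom k le_rfl, coeff_X_pow, if_pos rfl]
    have : 0 < δ := hpos
    linarith

lemma continuous_momentMap (n k : ℕ) : Continuous (momentMap n k) :=
  LinearMap.continuous_of_finiteDimensional _

lemma momentMap_image_carrier_psi (n k : ℕ) :
    momentMap n k '' carrier (psi k n) = momentMap n k '' Set.Icc (-1) 1 := by
  refine (Set.image_mono carrier_psi_subset_Icc).antisymm ?_
  rintro _ ⟨y, hy, rfl⟩
  have hcomp : IsCompact (Set.Icc (-1 : Fin n → ℝ) 1 ∩ momentMap n k ⁻¹' {momentMap n k y}) :=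
    isCompact_Icc.inter_right (isClosed_singleton.preimage (continuous_momentMap n k))
  obtain ⟨x, ⟨hx, hxy⟩, hmin⟩ := hcomp.exists_isMinOn ⟨y, hy, rfl⟩
    (f := fun x => ∑ l, x l * node l ^ k) (by fun_prop)
  refine ⟨x, mem_carrier_psi.2 ⟨hx, fun h => ?_⟩, hxy⟩
  obtain ⟨z, hz, hzx, hlt⟩ := h.exists_decrease hx
  exact (hmin ⟨hz, hzx.trans hxy⟩).not_gt hlt

/-! ### The zonotope and its frontier -/

/-- A vector orthogonal to the range would give a nonzero polynomial of degree < k with k roots. -/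
lemma momentMap_surjective {n k : ℕ} (hk : k ≤ n) : Function.Surjective (momentMap n k) := by
  rw [← LinearMap.range_eq_top]
  by_contra hne
  obtain ⟨c, hc, h0⟩ := Submodule.exists_mem_ne_zero_of_ne_bot
    (mt (Submodule.orthogonal_eq_bot_iff).1 hne)
  have hev : ∀ j : Fin k, (coeffPoly c).eval (node (Fin.castLE hk j)) = 0 := fun j => by
    have := (Submodule.mem_orthogonal' _ _).1 hc _
      (LinearMap.mem_range_self (momentMap n k) (Pi.single (Fin.castLE hk j) 1))
    simpa [inner_momentMap, Pi.single_apply] using this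
  exact coeffPoly_ne_zero h0
    (eq_zero_of_eval_node_eq_zero (degree_coeffPoly_lt c) (Fin.strictMono_castLE hk) hev)

lemma interior_momentMap_image_nonempty {n k : ℕ} (hk : k ≤ n) :
    (interior (momentMap n k '' Set.Icc (-1) 1)).Nonempty := by
  have hopen := (momentMap n k).isOpenMap_of_finiteDimensional (momentMap_surjective hk)
  have h0 : (0 : Fin n → ℝ) ∈ interior (Set.Icc (-1) 1) := by
    rw [mem_interior_iff_mem_nhds]
    rw [← Set.pi_univ_Icc]
    exact set_pi_mem_nhds Set.finite_univ fun i _ => Icc_mem_nhds (by simp) (by simp)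
  exact ⟨_, hopen.image_interior_subset _ ⟨0, h0, rfl⟩⟩

lemma convex_momentMap_image (n k : ℕ) : Convex ℝ (momentMap n k '' Set.Icc (-1) 1) :=
  (convex_Icc _ _).linear_image _

lemma isCompact_momentMap_image (n k : ℕ) : IsCompact (momentMap n k '' Set.Icc (-1) 1) :=
  isCompact_Icc.image (continuous_momentMap n k)

/-- At an interior point a linear functional with a local minimum would have zero derivative, hence
be zero. -/
lemma mem_frontier_of_supports {n k : ℕ} {x : Fin n → ℝ} (hx : x ∈ Set.Icc (-1) 1) {r : ℝ[X]}
    (h0 : r ≠ 0) (hr : r.degree < k) (h : Supports r x) :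
    momentMap n k x ∈ frontier (momentMap n k '' Set.Icc (-1) 1) := by
  rw [(isCompact_momentMap_image n k).isClosed.frontier_eq]
  refine ⟨Set.mem_image_of_mem _ hx, fun hint => h0 ?_⟩
  set c : EuclideanSpace ℝ (Fin k) := WithLp.toLp 2 fun m : Fin k => r.coeff m
  have hc : coeffPoly c = r := coeffPoly_eq_of_degree_lt hr
  have hmin : IsLocalMin (innerSL ℝ c) (momentMap n k x) := by
    filter_upwards [mem_interior_iff_mem_nhds.1 hint] with _ hp
    obtain ⟨y, hy, rfl⟩ := hp
    simp only [innerSL_apply_apply, inner_momentMap, hc]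
    exact Finset.sum_le_sum fun i _ => h.le hy i
  have hz := hmin.hasFDerivAt_eq_zero (innerSL ℝ c).hasFDerivAt
  have hcz : c = 0 := by
    have := congrArg (fun f => f c) hz
    simpa using this
  rw [← hc, hcz]
  simp [coeffPoly]

lemma exists_supports_of_mem_frontier {n k : ℕ} (hk : k ≤ n) {x : Fin n → ℝ}
    (hx : x ∈ Set.Icc (-1) 1)
    (h : momentMap n k x ∈ frontier (momentMap n k '' Set.Icc (-1) 1)) :
    ∃ r : ℝ[X], r ≠ 0 ∧ r.degree < k ∧ Supports r x := by
  set Z := momentMap n k '' Set.Icc (-1) 1 with hZ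
  have hconv : Convex ℝ Z := convex_momentMap_image n k
  obtain ⟨f, hf⟩ := geometric_hahn_banach_point_open hconv.interior isOpen_interior h.2
  obtain ⟨p, hp⟩ := interior_momentMap_image_nonempty hk
  obtain ⟨c, rfl⟩ := (InnerProductSpace.toDual ℝ (EuclideanSpace ℝ (Fin k))).surjective f
  simp only [InnerProductSpace.toDual_apply_apply] at hf
  have hc : c ≠ 0 := by
    rintro rfl
    simpa using hf p hp
  have hle : ∀ q ∈ Z, inner ℝ c (momentMap n k x) ≤ inner ℝ c q := by
    have hcl : closure (interior Z) ⊆ {q | inner ℝ c (momentMap n k x) ≤ inner ℝ c q} :=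
      closure_minimal (fun q hq => (hf q hq).le)
        (isClosed_le continuous_const (continuous_const.inner continuous_id))
    intro q hq
    refine hcl ?_
    rw [hconv.closure_interior_eq_closure_of_nonempty_interior ⟨p, hp⟩]
    exact subset_closure hq
  refine ⟨coeffPoly c, coeffPoly_ne_zero hc, degree_coeffPoly_lt c, ?_⟩
  set r := coeffPoly c
  -- An explicit minimiser of the pairing with r over the cube. As x does at least as well, equality
  -- holds term by term.
  let y : Fin n → ℝ := fun i => -(SignType.sign (r.eval (node i)) : ℝ)
  have hy : y ∈ Set.Icc (-1) 1 := by
    have : ∀ i, -1 ≤ y i ∧ y i ≤ 1 := fun i => by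
      simp only [y]
      cases SignType.sign (r.eval (node i)) <;> norm_num
    exact ⟨fun i => (this i).1, fun i => (this i).2⟩
  have hys : Supports r y := fun i => by
    simp only [y, neg_mul, sign_mul_self]
  have hsum := hle _ ⟨y, hy, rfl⟩
  rw [inner_momentMap, inner_momentMap] at hsum
  have heq := (Finset.sum_eq_sum_iff_of_le fun i (_ : i ∈ univ) => hys.le hx i).1
    ((Finset.sum_le_sum fun i _ => hys.le hx i).antisymm hsum)
  intro i
  rw [← heq i (mem_univ i), hys i]

/-- Where r is nonzero, support forces x to be minus its sign. Avoiding the alternating values thus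
makes every term of the divided difference nonpositive; if all vanished, r would have k + 1 roots.
-/
lemma HasAlternation.coeff_neg_of_supports {n k : ℕ} {x : Fin n → ℝ} (hx : x ∈ Set.Icc (-1) 1)
    (h : HasAlternation k x) {r : ℝ[X]} (h0 : r ≠ 0) (hr : r.degree < (k + 1 : ℕ))
    (hs : Supports r x) : r.coeff k < 0 := by
  obtain ⟨i, hi, h⟩ := h
  obtain ⟨w, hw, hc⟩ := exists_dividedDifference hi
  have hle : ∀ j, w j * r.eval (node (i j)) ≤ 0 := fun j => by
    have hsj := hs (i j)
    have hj := h j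
    have hwj := hw j
    have h1 : x (i j) ≤ 1 := hx.2 _
    have h2 : -1 ≤ x (i j) := hx.1 _
    rcases neg_one_pow_eq_or ℝ (j : ℕ) with h3 | h3
    · rw [h3] at hj hwj
      refine mul_nonpos_of_nonneg_of_nonpos (by linarith) (not_lt.1 fun hpos => hj ?_)
      rw [abs_of_pos hpos] at hsj
      exact mul_right_cancel₀ hpos.ne' (by linarith)
    · rw [h3] at hj hwj
      refine mul_nonpos_of_nonpos_of_nonneg (by linarith) (not_lt.1 fun hneg => hj ?_)
      rw [abs_of_neg hneg] at hsj
      exact mul_right_cancel₀ hneg.ne (by linarith)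
  rw [hc r hr]
  refine lt_of_le_of_ne (Finset.sum_nonpos fun j _ => hle j) fun hz => h0 ?_
  refine eq_zero_of_eval_node_eq_zero hr hi fun j => ?_
  have hj := (Finset.sum_eq_zero_iff_of_nonpos fun j _ => hle j).1 hz j (mem_univ j)
  refine (mul_eq_zero.1 hj).resolve_left fun hwj => ?_
  simpa [hwj] using hw j

lemma Supports.neg {n : ℕ} {r : ℝ[X]} {x : Fin n → ℝ} (h : Supports r x) :
    Supports (-r) (-x) := fun i => by
  simpa using h i

lemma neg_mem_Icc_iff {n : ℕ} {x : Fin n → ℝ} :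
    -x ∈ Set.Icc (-1) 1 ↔ x ∈ Set.Icc (-1) 1 := by
  simp only [Set.mem_Icc, neg_le_neg_iff, neg_le (a := x), and_comm]

lemma exists_supports_of_mem_carrier_psi {n k : ℕ} (hk : k ≤ n) {x : Fin n → ℝ}
    (hx : x ∈ carrier (psi k n)) :
    ∃ r : ℝ[X], r ≠ 0 ∧ r.degree < (k + 1 : ℕ) ∧ Supports r x := by
  obtain ⟨w, hw, hx⟩ := hx
  refine ⟨wordPoly w, (wordPoly_monic w).ne_zero, ?_, supports_wordPoly hk hw hx⟩
  rw [degree_wordPoly hk hw]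
  exact_mod_cast Nat.lt_succ_self k

lemma mem_frontier_iff {n k : ℕ} (hk : k + 1 ≤ n) {x : Fin n → ℝ} (hx : x ∈ Set.Icc (-1) 1) :
    momentMap n (k + 1) x ∈ frontier (momentMap n (k + 1) '' Set.Icc (-1) 1) ↔
      x ∈ carrier (psi k n) ∪ carrier (omega k n) := by
  constructor
  · intro h
    obtain ⟨r, h0, hr, hs⟩ := exists_supports_of_mem_frontier hk hx h
    rw [Set.mem_union, mem_carrier_omega, mem_carrier_psi, mem_carrier_psi, neg_mem_Icc_iff]
    -- Alternations of both x and -x would make the k-th coefficients of r and of -r negative.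
    by_contra! hcon
    have h1 := (hcon.1 hx).coeff_neg_of_supports hx h0 hr hs
    have h2 := (hcon.2 hx).coeff_neg_of_supports (neg_mem_Icc_iff.2 hx) (neg_ne_zero.2 h0)
      (by rwa [degree_neg]) hs.neg
    rw [coeff_neg] at h2
    linarith
  · rintro (h | h)
    · obtain ⟨r, h0, hr, hs⟩ := exists_supports_of_mem_carrier_psi (by omega) h
      exact mem_frontier_of_supports hx h0 hr hs
    · obtain ⟨r, h0, hr, hs⟩ := exists_supports_of_mem_carrier_psi (by omega)
        (mem_carrier_omega.1 h)
      refine mem_frontier_of_supports hx (neg_ne_zero.2 h0) (by rwa [degree_neg]) ?_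
      simpa using hs.neg

lemma carrier_union_subset_carrier_psi_succ (n k : ℕ) :
    carrier (psi k n) ∪ carrier (omega k n) ⊆ carrier (psi (k + 1) n) := by
  rintro x (h | h)
  · rw [mem_carrier_psi] at h ⊢
    exact ⟨h.1, fun h' => h.2 h'.of_succ⟩
  · rw [mem_carrier_omega, mem_carrier_psi, neg_mem_Icc_iff] at h
    exact mem_carrier_psi.2 ⟨h.1, fun h' => h.2 h'.neg_of_succ⟩

/-! ### From the glued space to the disk -/

lemma isCompact_cell {n : ℕ} (w : Word n) : IsCompact (cell w) := by
  refine isCompact_Icc.of_isClosed_subset ?_ (cell_subset_Icc w)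
  have : cell w = ⋂ i, {p : Fin n → ℝ | (w i = 0 → p i ∈ Set.Icc (-1 : ℝ) 1) ∧
      (w i ≠ 0 → p i = (w i : ℝ))} := by
    ext p
    simp [cell]
  rw [this]
  refine isClosed_iInter fun i => ?_
  by_cases h : w i = 0
  · convert (isClosed_Icc (a := (-1 : ℝ)) (b := 1)).preimage
      (continuous_apply (A := fun _ : Fin n => ℝ) i) using 1
    ext p
    simp [h]
  · convert (isClosed_singleton (x := (w i : ℝ))).preimage
      (continuous_apply (A := fun _ : Fin n => ℝ) i) using 1
    ext p
    simp [h]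

instance compactSpace_glued {n : ℕ} (A : Finset (Word n)) : CompactSpace (Glued A) := by
  have (x : {x : Word n // x ∈ A}) : CompactSpace {p : Fin n → ℝ // p ∈ cell x.1} :=
    isCompact_iff_compactSpace.1 (isCompact_cell x.1)
  infer_instance

lemma continuous_toCube {n : ℕ} (A : Finset (Word n)) : Continuous (Glued.toCube A) :=
  continuous_quot_lift _ (continuous_sigma fun _ => continuous_subtype_val)

lemma range_toCube {n : ℕ} (A : Finset (Word n)) : Set.range (Glued.toCube A) = carrier A := by
  ext p
  constructor
  · rintro ⟨⟨a⟩, rfl⟩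
    exact ⟨a.1.1, a.1.2, a.2.2⟩
  · rintro ⟨w, hw, hp⟩
    exact ⟨Quot.mk _ ⟨⟨w, hw⟩, ⟨p, hp⟩⟩, rfl⟩

lemma signType_cast_injective : Function.Injective ((↑) : SignType → ℝ) := by
  intro a b
  cases a <;> cases b <;> norm_num

/-- A point of `cell v` off its boundary is not ±1 on any free coordinate of v, so these are free in
w too; equal counts then force v = w. Hence gluing along boundaries already identifies all
coinciding points. -/
lemma mem_cellBoundary_of_mem_cell {n : ℕ} {v w : Word n} (hc : #(zeros v) = #(zeros w))
    (hne : v ≠ w) {p : Fin n → ℝ} (hv : p ∈ cell v) (hw : p ∈ cell w) : p ∈ cellBoundary v := by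
  refine ⟨hv, ?_⟩
  by_contra! hcon
  have hsub : zeros v ⊆ zeros w := fun i hi => by
    rw [mem_zeros] at hi ⊢
    by_contra h0
    have h1 := (hw i).2 h0
    have h2 := hcon i hi
    cases h : w i <;> simp_all
  have heq := Finset.eq_of_subset_of_card_le hsub hc.ge
  refine hne (funext fun i => ?_)
  by_cases h0 : v i = 0
  · rw [h0, eq_comm, ← mem_zeros, ← heq, mem_zeros, h0]
  · have h1 : w i ≠ 0 := fun h => h0 (by rwa [← mem_zeros, heq, mem_zeros])
    exact signType_cast_injective (((hv i).2 h0).symm.trans ((hw i).2 h1))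

lemma toCube_injective {n k : ℕ} {A : Finset (Word n)} (hA : ∀ w ∈ A, #(zeros w) = k) :
    Function.Injective (Glued.toCube A) := by
  rintro ⟨⟨⟨v, hv⟩, ⟨p, hp⟩⟩⟩ ⟨⟨⟨w, hw⟩, ⟨q, hq⟩⟩⟩ h
  obtain rfl : p = q := h
  by_cases hvw : v = w
  · subst hvw
    rfl
  · have hc := (hA v hv).trans (hA w hw).symm
    exact Quot.sound ⟨rfl, mem_cellBoundary_of_mem_cell hc hvw hp hq,
      mem_cellBoundary_of_mem_cell hc.symm (Ne.symm hvw) hq hp⟩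

/-- A continuous map that is injective on the carrier and has a convex body as its image
identifies the glued space with a disk. -/
lemma exists_homeomorph_disk {n k : ℕ} {A : Finset (Word n)} (hA : ∀ w ∈ A, #(zeros w) = k)
    {P : (Fin n → ℝ) → EuclideanSpace ℝ (Fin k)} (hP : Continuous P)
    (hinj : Set.InjOn P (carrier A)) {Z : Set (EuclideanSpace ℝ (Fin k))}
    (hZ : P '' carrier A = Z) (hcomp : IsCompact Z) (hconv : Convex ℝ Z)
    (hne : (interior Z).Nonempty) :
    ∃ h : Glued A ≃ₜ Disk k,
      Glued.toCube A '' (h ⁻¹' diskBoundary k) = {x ∈ carrier A | P x ∈ frontier Z} := by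
  -- This homeomorphism of the ambient space takes Z to the unit ball and its frontier to the
  -- sphere.
  obtain ⟨e, -, hball, hsph⟩ :=
    exists_homeomorph_image_interior_closure_frontier_eq_unitBall hconv hne hcomp.isBounded
  rw [hcomp.isClosed.closure_eq] at hball
  have hmem : ∀ a : Glued A, Glued.toCube A a ∈ carrier A := fun a =>
    range_toCube A ▸ Set.mem_range_self a
  let g : Glued A → Disk k := fun a => ⟨e (P (Glued.toCube A a)), by
    rw [← mem_closedBall_zero_iff, ← hball, ← hZ]
    exact Set.mem_image_of_mem _ (Set.mem_image_of_mem _ (hmem a))⟩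
  have hg : Continuous g :=
    (e.continuous.comp (hP.comp (continuous_toCube A))).subtype_mk _
  have hbij : Function.Bijective g := by
    constructor
    · intro a b hab
      exact toCube_injective hA
        (hinj (hmem a) (hmem b) (e.injective (congrArg Subtype.val hab)))
    · rintro ⟨v, hv⟩
      rw [← mem_closedBall_zero_iff, ← hball, ← hZ, ← range_toCube] at hv
      obtain ⟨_, ⟨_, ⟨a, rfl⟩, rfl⟩, rfl⟩ := hv
      exact ⟨a, rfl⟩
  refine ⟨hg.homeoOfEquivCompactToT2 (f := Equiv.ofBijective g hbij), ?_⟩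
  have hbd : ∀ a, g a ∈ diskBoundary k ↔ P (Glued.toCube A a) ∈ frontier Z := fun a => by
    rw [← e.injective.mem_set_image (s := frontier Z), hsph, mem_sphere_zero_iff_norm]
    rfl
  ext x
  constructor
  · rintro ⟨a, ha, rfl⟩
    exact ⟨hmem a, (hbd a).1 ha⟩
  · rintro ⟨hx, hf⟩
    rw [← range_toCube] at hx
    obtain ⟨a, rfl⟩ := hx
    exact ⟨a, (hbd a).2 hf, rfl⟩

/-! ### Transfer to `omega` by the symmetry x ↦ -x -/

lemma card_zeros_neg {n : ℕ} (w : Word n) : #(zeros (-w)) = #(zeros w) := by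
  congr 1
  ext i
  rw [mem_zeros, mem_zeros, Pi.neg_apply]
  cases w i <;> decide

lemma card_zeros_of_mem {n k : ℕ} (hk : k ≤ n) {A : Finset (Word n)}
    (hA : A = psi k n ∨ A = omega k n) : ∀ w ∈ A, #(zeros w) = k := by
  intro w hw
  rcases hA with rfl | rfl
  · exact (psi_word_spec hk hw).1
  · rw [omega_eq_image_neg, mem_image] at hw
    obtain ⟨v, hv, rfl⟩ := hw
    rw [card_zeros_neg, (psi_word_spec hk hv).1]

lemma momentMap_injOn_carrier_omega {n k : ℕ} (hk : k ≤ n) :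
    Set.InjOn (momentMap n k) (carrier (omega k n)) := by
  intro x hx y hy h
  refine neg_injective (momentMap_injOn_carrier_psi hk (mem_carrier_omega.1 hx)
    (mem_carrier_omega.1 hy) ?_)
  rw [map_neg, map_neg, h]

lemma carrier_omega_subset_Icc {n k : ℕ} : carrier (omega k n) ⊆ Set.Icc (-1) 1 :=
  fun _ hx => neg_mem_Icc_iff.1 (carrier_psi_subset_Icc (mem_carrier_omega.1 hx))

lemma momentMap_image_carrier_omega (n k : ℕ) :
    momentMap n k '' carrier (omega k n) = momentMap n k '' Set.Icc (-1) 1 := by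
  refine (Set.image_mono carrier_omega_subset_Icc).antisymm ?_
  rintro _ ⟨y, hy, rfl⟩
  obtain ⟨x, hx, hxy⟩ := (momentMap_image_carrier_psi n k).ge ⟨-y, neg_mem_Icc_iff.2 hy, rfl⟩
  refine ⟨-x, mem_carrier_omega.2 (by rwa [neg_neg]), ?_⟩
  rw [map_neg, hxy, map_neg, neg_neg]

lemma carrier_union_subset_carrier_omega_succ (n k : ℕ) :
    carrier (psi k n) ∪ carrier (omega k n) ⊆ carrier (omega (k + 1) n) := by
  intro x hx
  refine mem_carrier_omega.2 (carrier_union_subset_carrier_psi_succ n k ?_)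
  rw [Set.mem_union, mem_carrier_omega, neg_neg, or_comm]
  simpa only [Set.mem_union, mem_carrier_omega] using hx

/-- The carrier of a source or target `k`-face is a section of the moment map over the image of
the cube, and it contains the carriers of the faces one dimension lower. -/
lemma carrier_isSection {n k : ℕ} (hk : k ≤ n) {A : Finset (Word n)}
    (hA : A = psi k n ∨ A = omega k n) :
    Set.InjOn (momentMap n k) (carrier A) ∧
      momentMap n k '' carrier A = momentMap n k '' Set.Icc (-1) 1 ∧
      carrier A ⊆ Set.Icc (-1) 1 ∧
      ∀ m, k = m + 1 → carrier (psi m n) ∪ carrier (omega m n) ⊆ carrier A := by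
  rcases hA with rfl | rfl
  · refine ⟨momentMap_injOn_carrier_psi hk, momentMap_image_carrier_psi n k,
      carrier_psi_subset_Icc, ?_⟩
    rintro m rfl
    exact carrier_union_subset_carrier_psi_succ n m
  · refine ⟨momentMap_injOn_carrier_omega hk, momentMap_image_carrier_omega n k,
      carrier_omega_subset_Icc, ?_⟩
    rintro m rfl
    exact carrier_union_subset_carrier_omega_succ n m

end OrientedCube

theorem theorem4p2 (n k : ℕ) (hk : k ≤ n) (A : Finset (OrientedCube.Word n))
    (hA : A = OrientedCube.psi k n ∨ A = OrientedCube.omega k n) :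
    ∃ h : OrientedCube.Glued A ≃ₜ OrientedCube.Disk k,
      (1 ≤ k →
        OrientedCube.Glued.toCube A '' (h ⁻¹' OrientedCube.diskBoundary k) =
          OrientedCube.carrier (OrientedCube.psi (k - 1) n) ∪
            OrientedCube.carrier (OrientedCube.omega (k - 1) n)) := by
  obtain ⟨hinj, himg, hcube, hbd⟩ := OrientedCube.carrier_isSection hk hA
  obtain ⟨h, hh⟩ := OrientedCube.exists_homeomorph_disk (OrientedCube.card_zeros_of_mem hk hA)
    (OrientedCube.continuous_momentMap n k) hinj himg (OrientedCube.isCompact_momentMap_image n k)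
    (OrientedCube.convex_momentMap_image n k) (OrientedCube.interior_momentMap_image_nonempty hk)
  refine ⟨h, fun hk1 => ?_⟩
  obtain ⟨m, rfl⟩ := Nat.exists_eq_add_of_le' hk1
  rw [hh, Nat.add_sub_cancel]
  ext x
  constructor
  · rintro ⟨hx, hf⟩
    exact (OrientedCube.mem_frontier_iff hk (hcube hx)).1 hf
  · intro hx
    have hxA := hbd m rfl hx
    exact ⟨hxA, (OrientedCube.mem_frontier_iff hk (hcube hxA)).2 hx⟩
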